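/- Let $R$ be an associative ring with unity; all modules are left $R$-modules. A module $M$ is $\Sigma$-injective if the direct sum $M^{(I)}$ is injective for every set $I$; it is $\Sigma$-pure-injective if $M^{(\aleph_0)}$ is pure-injective (a module is pure-injective if homomorphisms into it extend along all pure embeddings, where $f\colon A\to B$ is a pure embedding if it is injective and every finite system of $R$-linear equations with constants in $A$ that is solvable in $B$, after replacing the constants by their images under $f$, is solvable in $A$); it is semisimple if it is a direct sum of simple modules. A class $K$ of modules is $\lambda$-categorical, for a cardinal $\lambda$, if $K$ contains a module of cardinality $\lambda$ and any two modules in $K$ of cardinality $\lambda$ are isomorphic. Let $K$ be the class of $\Sigma$-injective $R$-modules, or the class of $\Sigma$-pure-injective $R$-modules, or the class of semisimple $R$-modules. Then the following are equivalent: 1. $K$ is $\lambda$-categorical in all cardinals $\lambda>\mathrm{card}(R)+\aleph_0$. 2. $K$ is $\lambda$-categorical in some cardinal $\lambda>\mathrm{card}(R)+\aleph_0$. -/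

import Mathlib

universe u

namespace ModuleCategoricity

/-- An `R`-linear map `f : M → N` of left `R`-modules is a pure embedding: it is injective, and every
finite system of linear equations over `R` with right-hand sides in `M` which has a solution in `N`
(after transport along `f`) already has a solution in `M`. In other words, `f` reflects positive
primitive formulas, i.e. `f` identifies `M` with a pure submodule of `N`. -/
def IsPureEmbedding {R : Type u} [Ring R] {M N : Type u} [AddCommGroup M] [Module R M]
    [AddCommGroup N] [Module R N] (f : M →ₗ[R] N) : Prop :=
  Function.Injective f ∧
    ∀ (m n : ℕ) (A : Matrix (Fin m) (Fin n) R) (b : Fin m → M),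
      (∃ y : Fin n → N, ∀ i, ∑ j, A i j • y j = f (b i)) →
        ∃ x : Fin n → M, ∀ i, ∑ j, A i j • x j = b i

/-- A left `R`-module `M` is pure-injective if every homomorphism into `M` extends along every pure
embedding. -/
def IsPureInjective (R : Type u) [Ring R] (M : Type u) [AddCommGroup M] [Module R M] : Prop :=
  ∀ (A B : Type u) [AddCommGroup A] [Module R A] [AddCommGroup B] [Module R B]
    (i : A →ₗ[R] B), IsPureEmbedding i → ∀ g : A →ₗ[R] M, ∃ h : B →ₗ[R] M, h ∘ₗ i = g

/-- `M` is `Σ`-injective if the direct sum `M^(I)` is injective for every set `I`. -/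
def IsSigmaInjective (R : Type u) [Ring R] (M : Type u) [AddCommGroup M] [Module R M] : Prop :=
  ∀ I : Type u, Module.Injective R (I →₀ M)

/-- `M` is `Σ`-pure-injective if the countable direct sum `M^(ℵ₀)` is pure-injective. -/
def IsSigmaPureInjective (R : Type u) [Ring R] (M : Type u) [AddCommGroup M] [Module R M] : Prop :=
  IsPureInjective R (ℕ →₀ M)

/-- A class `K` of left `R`-modules is `κ`-categorical if it has a member of cardinality `κ` and any
two members of cardinality `κ` are isomorphic. -/
def IsCategorical (R : Type u) [Ring R]
    (K : ∀ (M : Type u) [AddCommGroup M] [Module R M], Prop) (κ : Cardinal.{u}) : Prop :=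
  (∃ (M : Type u) (_ : AddCommGroup M) (_ : Module R M), K M ∧ Cardinal.mk M = κ) ∧
    ∀ (M N : Type u) [AddCommGroup M] [Module R M] [AddCommGroup N] [Module R N],
      K M → Cardinal.mk M = κ → K N → Cardinal.mk N = κ → Nonempty (M ≃ₗ[R] N)

end ModuleCategoricity

/-! Every module in `K` is a direct sum of pieces of size at most `#R + ℵ₀`: simple modules in the
semisimple case, indecomposable ones otherwise. A piece `E` is recovered from any nonempty direct
power of itself. If `K` is categorical in one large `κ`, then for pieces `E`, `F` the powers `E^(κ)`
and `F^(κ)` lie in `K` and have size `κ`, so they are isomorphic and `E ≅ F`. Hence there is a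
single piece up to isomorphism, and a member of `K` of large size `μ` must be `E^(μ)`. This argument
is `isCategorical_transfer`.

For the two injectivity classes everything rests on the descending chain condition on positive
primitive (pp) subgroups. It is equivalent to Σ-pure-injectivity (`isSigmaPureInjective_iff`) and
follows from Σ-injectivity. It makes pure submodules split, which gives the decomposition
(`IsPPArtinian.exists_decomposition`) and the size bound (`IsIndecomposable.mk_le`). Recovery
(`IsIndecomposable.nonempty_linearEquiv_of_finsupp`) takes an element of a minimal pp subgroup and
shows that an endomorphism with a nonzero fixed point has a left inverse. -/

namespace ModuleCategoricity

/-! ### Solvability of linear systems -/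

section Systems

variable {R : Type u} [Ring R]

/-- The finite system of linear equations `A x = b` has a solution in `M`. -/
def Solvable {ι κ : Type*} [Fintype κ] {M : Type*} [AddCommGroup M] [Module R M]
    (A : Matrix ι κ R) (b : ι → M) : Prop :=
  ∃ x : κ → M, ∀ i, ∑ j, A i j • x j = b i

variable {M N P : Type*} [AddCommGroup M] [Module R M] [AddCommGroup N] [Module R N]
  [AddCommGroup P] [Module R P] {ι κ : Type*} [Fintype κ] {A : Matrix ι κ R}

theorem Solvable.map {b : ι → M} (h : Solvable A b) (f : M →ₗ[R] N) :
    Solvable A (fun i => f (b i)) := by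
  obtain ⟨x, hx⟩ := h
  exact ⟨fun j => f (x j), fun i => by simp [← hx i]⟩

theorem Solvable.add {b c : ι → M} (hb : Solvable A b) (hc : Solvable A c) :
    Solvable A (fun i => b i + c i) := by
  obtain ⟨x, hx⟩ := hb
  obtain ⟨y, hy⟩ := hc
  exact ⟨fun j => x j + y j, fun i => by simp [smul_add, Finset.sum_add_distrib, hx, hy]⟩

theorem Solvable.sub {b c : ι → M} (hb : Solvable A b) (hc : Solvable A c) :
    Solvable A (fun i => b i - c i) := by
  obtain ⟨x, hx⟩ := hb
  obtain ⟨y, hy⟩ := hc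
  exact ⟨fun j => x j - y j, fun i => by simp [smul_sub, Finset.sum_sub_distrib, hx, hy]⟩

theorem Solvable.zero : Solvable A (fun _ => (0 : M)) :=
  ⟨fun _ => 0, fun i => by simp⟩

theorem Solvable.reindex {ι' κ' : Type*} [Fintype κ'] (e : ι ≃ ι') (e' : κ ≃ κ') {b : ι → M} :
    Solvable (Matrix.reindex e e' A) (fun i => b (e.symm i)) ↔ Solvable A b := by
  constructor
  · rintro ⟨x, hx⟩
    refine ⟨fun j => x (e' j), fun i => ?_⟩
    have := hx (e i)
    rw [← Equiv.sum_comp e'] at this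
    simpa using this
  · rintro ⟨x, hx⟩
    refine ⟨fun j => x (e'.symm j), fun i => ?_⟩
    have := hx (e.symm i)
    rw [← Equiv.sum_comp e'.symm] at this
    simpa using this

end Systems

/-! ### Pure embeddings and pure-injectivity -/

section Pure

variable {R : Type u} [Ring R] {M N P : Type u} [AddCommGroup M] [Module R M] [AddCommGroup N]
  [Module R N] [AddCommGroup P] [Module R P]

theorem IsPureEmbedding.reflect {f : M →ₗ[R] N} (hf : IsPureEmbedding f) {ι κ : Type*}
    [Finite ι] [Fintype κ] {A : Matrix ι κ R} {b : ι → M}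
    (h : Solvable A (fun i => f (b i))) : Solvable A b := by
  have := Fintype.ofFinite ι
  have e := Fintype.equivFin ι
  have e' := Fintype.equivFin κ
  rw [← Solvable.reindex e e'] at h ⊢
  exact hf.2 _ _ _ _ h

theorem isPureEmbedding_of_reflect {f : M →ₗ[R] N}
    (h : ∀ (m n : ℕ) (A : Matrix (Fin m) (Fin n) R) (b : Fin m → M),
      Solvable A (fun i => f (b i)) → Solvable A b) : IsPureEmbedding f := by
  refine ⟨(injective_iff_map_eq_zero f).2 fun x hx => ?_, h⟩
  -- One equation in no unknowns, `0 = x`: reflecting it is injectivity.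
  obtain ⟨y, hy⟩ := h 1 0 0 (fun _ => x) ⟨fun _ => 0, fun _ => by simp [hx]⟩
  simpa using (hy 0).symm

theorem isPureEmbedding_of_comp_eq_id {f : M →ₗ[R] N} {r : N →ₗ[R] M}
    (h : ∀ x, r (f x) = x) : IsPureEmbedding f :=
  isPureEmbedding_of_reflect fun _ _ _ _ hb => by simpa [h] using hb.map r

theorem isPureEmbedding_subtype_iff {U : Submodule R M} : IsPureEmbedding U.subtype ↔
    ∀ (m n : ℕ) (A : Matrix (Fin m) (Fin n) R) (b : Fin m → M), (∀ i, b i ∈ U) →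
      Solvable A b → ∃ x : Fin n → M, (∀ j, x j ∈ U) ∧ ∀ i, ∑ j, A i j • x j = b i := by
  constructor
  · intro h m n A b hb hs
    obtain ⟨x, hx⟩ := h.2 m n A (fun i => ⟨b i, hb i⟩) hs
    exact ⟨fun j => x j, fun j => (x j).2, fun i => by simpa using congrArg U.subtype (hx i)⟩
  · intro h
    refine isPureEmbedding_of_reflect fun m n A b hs => ?_
    obtain ⟨x, hx, hs⟩ := h m n A (fun i => b i) (fun i => (b i).2) hs
    exact ⟨fun j => ⟨x j, hx j⟩, fun i => Subtype.ext (by simpa using hs i)⟩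

theorem exists_mem_chain_of_forall_mem_sSup {c : Set (Submodule R M)} (hc : IsChain (· ≤ ·) c)
    (hne : c.Nonempty) {ι : Type*} [Finite ι] (x : ι → M) (hx : ∀ i, x i ∈ sSup c) :
    ∃ L ∈ c, ∀ i, x i ∈ L := by
  have := hne.to_subtype
  have h1 : ∀ i, ∃ L : c, x i ∈ L.1 := fun i => by
    obtain ⟨L, hL, h⟩ := (Submodule.mem_sSup_of_directed hne hc.directedOn).1 (hx i)
    exact ⟨⟨L, hL⟩, h⟩
  choose L hL using h1
  obtain ⟨K, hK⟩ := hc.directed.finite_le L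
  exact ⟨K.1, K.2, fun i => hK i (hL i)⟩

theorem isPureEmbedding_subtype_sSup {c : Set (Submodule R M)} (hc : IsChain (· ≤ ·) c)
    (hne : c.Nonempty) (hp : ∀ U ∈ c, IsPureEmbedding U.subtype) :
    IsPureEmbedding (sSup c).subtype := by
  rw [isPureEmbedding_subtype_iff]
  intro m n A b hb hs
  obtain ⟨U, hU, hbU⟩ := exists_mem_chain_of_forall_mem_sSup hc hne b hb
  obtain ⟨x, hx, h⟩ := isPureEmbedding_subtype_iff.1 (hp U hU) m n A b hbU hs
  exact ⟨x, fun j => le_sSup hU (hx j), h⟩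

/-- Pushing out along a map that preserves solvability of systems yields a pure embedding. -/
theorem exists_pushout {X B : Type u} [AddCommGroup X] [Module R X] [AddCommGroup B] [Module R B]
    (u : X →ₗ[R] B) (v : X →ₗ[R] M)
    (h : ∀ (m n : ℕ) (A : Matrix (Fin m) (Fin n) R) (b : Fin m → X),
      Solvable A (fun i => u (b i)) → Solvable A (fun i => v (b i))) :
    ∃ (Q : Type u) (_ : AddCommGroup Q) (_ : Module R Q) (j : M →ₗ[R] Q) (w : B →ₗ[R] Q),
      IsPureEmbedding j ∧ w ∘ₗ u = j ∘ₗ v := by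
  let K : Submodule R (M × B) := LinearMap.range (v.prod (-u))
  refine ⟨(M × B) ⧸ K, inferInstance, inferInstance, K.mkQ ∘ₗ LinearMap.inl R M B,
    K.mkQ ∘ₗ LinearMap.inr R M B, isPureEmbedding_of_reflect fun m n A b hb => ?_, ?_⟩
  · obtain ⟨y, hy⟩ := hb
    choose y' hy' using fun j => K.mkQ_surjective (y j)
    -- A lifted solution is wrong by some `(v a, -u a)`. The second coordinate solves the system
    -- with constants `u (-a)` in `B`, so `v (-a)` is solvable in `M`; adding it to the first
    -- coordinate leaves `b`.
    have h1 : ∀ i, ∃ a : X, v a = ∑ j, A i j • (y' j).1 - b i ∧ -u a = ∑ j, A i j • (y' j).2 := by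
      intro i
      have : ∑ j, A i j • y' j - (b i, 0) ∈ K := by
        rw [← K.ker_mkQ, LinearMap.mem_ker, map_sub, map_sum, sub_eq_zero]
        simpa [hy'] using hy i
      obtain ⟨a, ha⟩ := this
      refine ⟨a, ?_, ?_⟩
      · simpa [Prod.fst_sum] using congrArg Prod.fst ha
      · simpa [Prod.snd_sum] using congrArg Prod.snd ha
    choose a ha ha' using h1
    have h2 : Solvable A (fun i => v (-a i)) :=
      h m n A (fun i => -a i) ⟨fun j => (y' j).2, fun i => by simp [← ha' i]⟩
    have h3 : Solvable A (fun i => v (a i) + b i) :=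
      ⟨fun j => (y' j).1, fun i => by simp [ha i]⟩
    simpa using h2.add h3
  · ext x
    have : ((0, u x) : M × B) - (v x, 0) ∈ K := ⟨-x, by simp⟩
    simpa using (Submodule.Quotient.eq K).2 this

theorem IsPureInjective.exists_retraction (hM : IsPureInjective R M) {f : M →ₗ[R] P}
    (hf : IsPureEmbedding f) : ∃ r : P →ₗ[R] M, ∀ x, r (f x) = x := by
  obtain ⟨r, hr⟩ := hM M P f hf LinearMap.id
  exact ⟨r, fun x => LinearMap.congr_fun hr x⟩

/-- The pushout of `u` along `v` embeds `M` purely, and a retraction of that embedding gives the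
factorization. As `u` need not be pure, this also extends maps known only to preserve pp conditions.
-/
theorem exists_factor_of_retraction
    (hM : ∀ (P : Type u) [AddCommGroup P] [Module R P] (f : M →ₗ[R] P), IsPureEmbedding f →
      ∃ r : P →ₗ[R] M, ∀ x, r (f x) = x)
    {X B : Type u} [AddCommGroup X] [Module R X] [AddCommGroup B] [Module R B]
    (u : X →ₗ[R] B) (v : X →ₗ[R] M)
    (h : ∀ (m n : ℕ) (A : Matrix (Fin m) (Fin n) R) (b : Fin m → X),
      Solvable A (fun i => u (b i)) → Solvable A (fun i => v (b i))) :
    ∃ k : B →ₗ[R] M, ∀ x, k (u x) = v x := by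
  obtain ⟨Q, _, _, j, w, hj, hw⟩ := exists_pushout u v h
  obtain ⟨r, hr⟩ := hM Q j hj
  exact ⟨r ∘ₗ w, fun x => by
    simpa [hr] using congrArg r (LinearMap.congr_fun hw x)⟩

theorem IsPureInjective.exists_factor (hM : IsPureInjective R M)
    {X B : Type u} [AddCommGroup X] [Module R X] [AddCommGroup B] [Module R B]
    (u : X →ₗ[R] B) (v : X →ₗ[R] M)
    (h : ∀ (m n : ℕ) (A : Matrix (Fin m) (Fin n) R) (b : Fin m → X),
      Solvable A (fun i => u (b i)) → Solvable A (fun i => v (b i))) :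
    ∃ k : B →ₗ[R] M, ∀ x, k (u x) = v x :=
  exists_factor_of_retraction (fun _ _ _ _ => hM.exists_retraction) u v h

theorem isPureInjective_of_retraction
    (hM : ∀ (P : Type u) [AddCommGroup P] [Module R P] (f : M →ₗ[R] P), IsPureEmbedding f →
      ∃ r : P →ₗ[R] M, ∀ x, r (f x) = x) : IsPureInjective R M := by
  intro A B _ _ _ _ i hi g
  obtain ⟨k, hk⟩ := exists_factor_of_retraction hM i g fun m n A b hb => (hi.reflect hb).map g
  exact ⟨k, LinearMap.ext hk⟩

end Pure

/-! ### Positive primitive subgroups and their chain condition -/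

section PPFormula

/-- A positive primitive formula in one variable: `∃ z, A z = c x`. -/
structure PPFormula (R : Type u) where
  ι : Type
  κ : Type
  [finite : Finite ι]
  [fintype : Fintype κ]
  A : Matrix ι κ R
  c : ι → R

attribute [instance] PPFormula.finite PPFormula.fintype

variable {R : Type u} [Ring R]

/-- The subset of `M` defined by a positive primitive formula. -/
def PPFormula.carrier (φ : PPFormula R) (M : Type*) [AddCommGroup M] [Module R M] : Set M :=
  {x | Solvable φ.A (fun i => φ.c i • x)}

/-- The conjunction of two positive primitive formulas. -/
def PPFormula.conj (φ ψ : PPFormula R) : PPFormula R where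
  ι := φ.ι ⊕ ψ.ι
  κ := φ.κ ⊕ ψ.κ
  A := Matrix.fromBlocks φ.A 0 0 ψ.A
  c := Sum.elim φ.c ψ.c

theorem solvable_fromBlocks {M : Type*} [AddCommGroup M] [Module R M] {ι κ ι' κ' : Type*}
    [Fintype κ] [Fintype κ'] {A : Matrix ι κ R} {A' : Matrix ι' κ' R} {b : ι ⊕ ι' → M} :
    Solvable (Matrix.fromBlocks A 0 0 A') b ↔
      Solvable A (fun i => b (.inl i)) ∧ Solvable A' (fun i => b (.inr i)) := by
  constructor
  · rintro ⟨x, hx⟩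
    exact ⟨⟨fun j => x (.inl j), fun i => by simpa using hx (.inl i)⟩,
      ⟨fun j => x (.inr j), fun i => by simpa using hx (.inr i)⟩⟩
  · rintro ⟨⟨x, hx⟩, ⟨y, hy⟩⟩
    refine ⟨Sum.elim x y, ?_⟩
    rintro (i | i)
    · simpa using hx i
    · simpa using hy i

variable {M N : Type*} [AddCommGroup M] [Module R M] [AddCommGroup N] [Module R N]

theorem PPFormula.carrier_conj (φ ψ : PPFormula R) :
    (φ.conj ψ).carrier M = φ.carrier M ∩ ψ.carrier M :=
  Set.ext fun _ => solvable_fromBlocks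

theorem PPFormula.map_mem {φ : PPFormula R} {x : M} (hx : x ∈ φ.carrier M) (f : M →ₗ[R] N) :
    f x ∈ φ.carrier N := by
  simpa [PPFormula.carrier] using Solvable.map hx f

theorem PPFormula.zero_mem (φ : PPFormula R) : (0 : M) ∈ φ.carrier M := by
  simpa [PPFormula.carrier] using Solvable.zero

theorem PPFormula.neg_mem {φ : PPFormula R} {x : M} (hx : x ∈ φ.carrier M) :
    -x ∈ φ.carrier M := by
  simpa using PPFormula.map_mem hx (-LinearMap.id)

/-- The formula satisfied by every element. -/
def PPFormula.top (R : Type u) : PPFormula R where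
  ι := Empty
  κ := Empty
  A := Empty.elim
  c := Empty.elim

theorem PPFormula.mem_top (x : M) : x ∈ (PPFormula.top R).carrier M :=
  ⟨Empty.elim, fun i => i.elim⟩

theorem PPFormula.carrier_finsupp (φ : PPFormula R) {I : Type*} {f : I →₀ M} :
    f ∈ φ.carrier (I →₀ M) ↔ ∀ i, f i ∈ φ.carrier M := by
  classical
  refine ⟨fun h i => PPFormula.map_mem h (Finsupp.lapply i), fun h => ?_⟩
  choose z hz using h
  refine ⟨fun j => Finsupp.indicator f.support fun k _ => z k j, fun i => ?_⟩
  ext k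
  by_cases hk : k ∈ f.support
  · simpa [Finsupp.finsetSum_apply, Finsupp.indicator_apply, Finsupp.mem_support_iff.1 hk]
      using hz k i
  · simp [Finsupp.finsetSum_apply, Finsupp.indicator_apply, Finsupp.notMem_support_iff.1 hk]

theorem PPFormula.carrier_pi (φ : PPFormula R) {I : Type*} {f : I → M}
    (h : ∀ i, f i ∈ φ.carrier M) : f ∈ φ.carrier (I → M) := by
  choose z hz using h
  exact ⟨fun j k => z k j, fun i => by ext k; simpa using hz k i⟩

variable (R M) in
/-- The descending chain condition on positive primitive definable subgroups. -/
def IsPPArtinian : Prop :=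
  WellFounded fun φ ψ : PPFormula R => φ.carrier M ⊂ ψ.carrier M

theorem IsPPArtinian.exists_minimal (hM : IsPPArtinian R M) {S : Set (PPFormula R)}
    (hS : S.Nonempty) :
    ∃ φ ∈ S, ∀ ψ ∈ S, ψ.carrier M ⊆ φ.carrier M → φ.carrier M ⊆ ψ.carrier M := by
  obtain ⟨φ, hφ, h⟩ := hM.has_min S hS
  exact ⟨φ, hφ, fun ψ hψ hle => by_contra fun hn => h ψ hψ ⟨hle, hn⟩⟩

theorem IsPPArtinian.finsupp (hM : IsPPArtinian R M) (I : Type*) : IsPPArtinian R (I →₀ M) := by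
  classical
  refine Subrelation.wf (fun {φ ψ} h => ?_) hM
  refine ⟨fun x hx => ?_, fun hle => h.2 fun f hf => ?_⟩
  · obtain ⟨f, hf, hf'⟩ := Set.exists_of_ssubset h
    have ⟨i⟩ : Nonempty I := by
      by_contra hI
      rw [not_nonempty_iff] at hI
      exact hf' (by rw [Subsingleton.elim f 0]; exact φ.zero_mem)
    have : Finsupp.single i x ∈ ψ.carrier (I →₀ M) := h.1 (φ.carrier_finsupp.2 fun j => ?_)
    · simpa using (ψ.carrier_finsupp.1 this) i
    · obtain rfl | hj := eq_or_ne i j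
      · simpa using hx
      · simpa [hj] using φ.zero_mem
  · exact φ.carrier_finsupp.2 fun i => hle (ψ.carrier_finsupp.1 hf i)

end PPFormula

section PPArtinian

variable {R : Type u} [Ring R] {M N P : Type u} [AddCommGroup M] [Module R M]
  [AddCommGroup N] [Module R N] [AddCommGroup P] [Module R P]

theorem IsPureEmbedding.mem_carrier {f : N →ₗ[R] M} (hf : IsPureEmbedding f) {φ : PPFormula R}
    {x : N} : f x ∈ φ.carrier M ↔ x ∈ φ.carrier N :=
  ⟨fun h => hf.reflect (b := fun i => φ.c i • x) (by simpa [PPFormula.carrier] using h),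
    fun h => PPFormula.map_mem h f⟩

/-- An inclusion between traces on `N` need not hold in `M`. So minimality in `M` is taken over all
formulas with the same trace as a member of `S`, and conjunction with a competitor restores the
inclusion. -/
theorem IsPPArtinian.of_pure (hM : IsPPArtinian R M) {f : N →ₗ[R] M} (hf : IsPureEmbedding f) :
    IsPPArtinian R N := by
  refine WellFounded.wellFounded_iff_has_min.2 fun S hS => ?_
  obtain ⟨χ, ⟨φ, hφ, hχ⟩, hmin⟩ := hM.exists_minimal
    (S := {χ | ∃ φ ∈ S, χ.carrier N = φ.carrier N}) (hS.imp fun φ hφ => ⟨φ, hφ, rfl⟩)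
  refine ⟨φ, hφ, fun ψ hψ hlt => hlt.2 fun x hx => ?_⟩
  have h := hmin (χ.conj ψ) ⟨ψ, hψ, by
    rw [PPFormula.carrier_conj, hχ, Set.inter_eq_right.2 hlt.1]⟩
    (by rw [PPFormula.carrier_conj]; exact Set.inter_subset_left)
  rw [PPFormula.carrier_conj] at h
  rw [← hχ, ← hf.mem_carrier] at hx
  exact hf.mem_carrier.1 (h hx).2

end PPArtinian
end ModuleCategoricity

namespace ModuleCategoricity

/-! ### The chain condition is Σ-pure-injectivity -/

section Retraction

variable {R : Type u} [Ring R] {M N P : Type u} [AddCommGroup M] [Module R M]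
  [AddCommGroup N] [Module R N] [AddCommGroup P] [Module R P]

theorem isPureEmbedding_mkQ_comp_iff {f : M →ₗ[R] P} {L : Submodule R P} :
    IsPureEmbedding (L.mkQ ∘ₗ f) ↔
      ∀ (m n : ℕ) (A : Matrix (Fin m) (Fin n) R) (b : Fin m → M) (y : Fin n → P),
        (∀ i, ∑ j, A i j • y j - f (b i) ∈ L) → Solvable A b := by
  constructor
  · intro h m n A b y hy
    refine h.2 m n A b ⟨fun j => L.mkQ (y j), fun i => ?_⟩
    have : L.mkQ (∑ j, A i j • y j) = L.mkQ (f (b i)) := (Submodule.Quotient.eq L).2 (hy i)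
    simpa only [map_sum, map_smul, LinearMap.comp_apply] using this
  · refine fun h => isPureEmbedding_of_reflect fun m n A b ⟨y, hy⟩ => ?_
    choose z hz using fun j => L.mkQ_surjective (y j)
    refine h m n A b z fun i => (Submodule.Quotient.eq L).1 ?_
    change L.mkQ (∑ j, A i j • z j) = L.mkQ (f (b i))
    simpa only [map_sum, map_smul, hz, LinearMap.comp_apply] using hy i

/-- Given a pure embedding of a module with the descending chain condition on positive primitive
subgroups, every element of the codomain can be identified with an element of the domain without
losing purity. -/
theorem IsPPArtinian.exists_pure_mkQ_span (hM : IsPPArtinian R M) {f : M →ₗ[R] P}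
    (hf : IsPureEmbedding f) (p : P) :
    ∃ m : M, IsPureEmbedding ((Submodule.span R {p - f m}).mkQ ∘ₗ f) := by
  let sat (φ : PPFormula R) (b : φ.ι → M) : Prop :=
    Solvable φ.A (fun i => φ.c i • p + f (b i))
  have sat_conj : ∀ {φ ψ : PPFormula R} {b c}, sat φ b → sat ψ c →
      sat (φ.conj ψ) (Sum.elim b c) := fun h h' => solvable_fromBlocks.2 ⟨h, h'⟩
  have realize : ∀ (φ : PPFormula R) (b : φ.ι → M), sat φ b →
      ∃ m : M, Solvable φ.A (fun i => φ.c i • m + b i) := by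
    rintro φ b ⟨y, hy⟩
    -- The element `p` becomes one more unknown, at `none`, so that purity can be applied.
    let A' : Matrix φ.ι (Option φ.κ) R := fun i j => j.elim (-φ.c i) (φ.A i)
    obtain ⟨x, hx⟩ := hf.reflect (A := A') (b := b)
      ⟨fun j => j.elim p y, fun i => by simp [A', Fintype.sum_option, hy i]⟩
    refine ⟨x none, fun j => x (some j), fun i => ?_⟩
    have h := hx i
    simp only [A', Fintype.sum_option, Option.elim, neg_smul] at h
    exact eq_add_of_neg_add_eq h
  -- Take a condition on `p` with parameters in `M` whose homogeneous part is minimal. Any other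
  -- condition on `p` has a common solution `v` with it in `M`; then `v - m` lies in the minimal
  -- subgroup, so `m` meets the other condition too.
  obtain ⟨φ, ⟨b, hb⟩, hmin⟩ := hM.exists_minimal (S := {φ | ∃ b, sat φ b})
    ⟨PPFormula.top R, Empty.elim, Empty.elim, fun i => i.elim⟩
  obtain ⟨m, hm⟩ := realize φ b hb
  refine ⟨m, isPureEmbedding_mkQ_comp_iff.2 fun k n A c y hy => ?_⟩
  choose r hr using fun i => Submodule.mem_span_singleton.1 (hy i)
  let ψ : PPFormula R := ⟨Fin k, Fin n, A, r⟩
  have hψ : sat ψ (fun i => c i - r i • m) := by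
    refine ⟨y, fun i => ?_⟩
    have h := hr i
    rw [eq_sub_iff_add_eq] at h
    simp only [ψ, ← h, map_sub, map_smul, smul_sub]
    abel
  have hsub : φ.carrier M ⊆ ψ.carrier M := by
    have h := hmin (φ.conj ψ) ⟨_, sat_conj hb hψ⟩
      (by rw [PPFormula.carrier_conj]; exact Set.inter_subset_left)
    rw [PPFormula.carrier_conj] at h
    exact fun x hx => (h hx).2
  obtain ⟨v, hv⟩ := realize _ _ (sat_conj hb hψ)
  obtain ⟨h1, h2⟩ := solvable_fromBlocks.1 hv
  have h3 : v - m ∈ ψ.carrier M := hsub (by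
    simpa [PPFormula.carrier, smul_sub, PPFormula.conj] using Solvable.sub h1 hm)
  have h4 := Solvable.sub h2 h3
  simpa [ψ, PPFormula.conj, smul_sub] using h4

/-- For `L` maximal with `M → P ⧸ L` pure, identifying one more element with an element of `M`
cannot enlarge `L`. So the map is onto, and its inverse gives the retraction. -/
theorem IsPPArtinian.exists_retraction (hM : IsPPArtinian R M) {f : M →ₗ[R] P}
    (hf : IsPureEmbedding f) : ∃ r : P →ₗ[R] M, ∀ x, r (f x) = x := by
  obtain ⟨L, -, hL⟩ := zorn_le_nonempty₀ {L : Submodule R P | IsPureEmbedding (L.mkQ ∘ₗ f)}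
    (fun c hc hchain L hL => ⟨sSup c, isPureEmbedding_mkQ_comp_iff.2 fun m n A b y hy => by
      obtain ⟨L, hL, h⟩ := exists_mem_chain_of_forall_mem_sSup hchain ⟨L, hL⟩ _ hy
      exact isPureEmbedding_mkQ_comp_iff.1 (hc hL) m n A b y h, fun _ => le_sSup⟩) ⊥
    (isPureEmbedding_mkQ_comp_iff.2 fun m n A b y hy =>
      hf.2 m n A b ⟨y, fun i => sub_eq_zero.1 (by simpa using hy i)⟩)
  have hpure : IsPureEmbedding (L.mkQ ∘ₗ f) := hL.1
  have hbij : Function.Bijective (L.mkQ ∘ₗ f) := by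
    refine ⟨hpure.1, fun q => ?_⟩
    obtain ⟨p, rfl⟩ := L.mkQ_surjective q
    obtain ⟨m, hm⟩ := hM.exists_pure_mkQ_span hpure (L.mkQ p)
    refine ⟨m, ?_⟩
    have hle : L ⊔ Submodule.span R {p - f m} ≤ L := by
      refine hL.2 (isPureEmbedding_mkQ_comp_iff.2 fun k n A b y hy => ?_) le_sup_left
      refine isPureEmbedding_mkQ_comp_iff.1 hm k n A b (fun j => L.mkQ (y j)) fun i => ?_
      have := Submodule.mem_map_of_mem (f := L.mkQ) (hy i)
      rw [Submodule.map_sup, Submodule.mkQ_map_self, bot_sup_eq, Submodule.map_span,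
        Set.image_singleton] at this
      simpa only [map_sub, map_sum, map_smul, LinearMap.comp_apply] using this
    have := hle (Submodule.mem_sup_right (Submodule.mem_span_singleton_self _))
    exact ((Submodule.Quotient.eq L).2 this).symm
  let e := LinearEquiv.ofBijective _ hbij
  exact ⟨e.symm.toLinearMap ∘ₗ L.mkQ, fun x => e.symm_apply_apply x⟩

theorem IsPPArtinian.isPureInjective (hM : IsPPArtinian R M) : IsPureInjective R M :=
  isPureInjective_of_retraction fun _ _ _ _ => hM.exists_retraction

/-- The direct sum is pure in the product, hence a retract. Given a strictly descending chain, pick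
`a n` in the `n`-th subgroup but not the next, and retract the sequence `a`. At an index `j` outside
the finite support of the image, `a j` is forced into subgroup `j + 1`. -/
theorem IsSigmaPureInjective.isPPArtinian (hM : IsSigmaPureInjective R M) :
    IsPPArtinian R M := by
  classical
  rw [IsPPArtinian, wellFounded_iff_isEmpty_descending_chain]
  refine ⟨fun ⟨φ, hφ⟩ => ?_⟩
  have hanti : Antitone fun n => (φ n).carrier M := antitone_nat_of_succ_le fun n => (hφ n).1
  choose a ha ha' using fun n => Set.exists_of_ssubset (hφ n)
  have hp : IsPureEmbedding (Finsupp.lcoeFun : (ℕ →₀ M) →ₗ[R] ℕ → M) := by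
    refine isPureEmbedding_of_reflect fun m n A b ⟨y, hy⟩ => ?_
    let s : Finset ℕ := Finset.univ.biUnion fun i => (b i).support
    refine ⟨fun j => Finsupp.indicator s fun k _ => y j k, fun i => ?_⟩
    ext k
    have h := congrFun (hy i) k
    by_cases hk : k ∈ s
    · simpa [Finsupp.finsetSum_apply, Finsupp.indicator_apply, hk] using h
    · have : b i k = 0 := by
        by_contra hne
        exact hk (Finset.mem_biUnion.2 ⟨i, Finset.mem_univ _, Finsupp.mem_support_iff.2 hne⟩)
      simp [Finsupp.finsetSum_apply, Finsupp.indicator_apply, hk, this]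
  obtain ⟨r, hr⟩ := IsPureInjective.exists_retraction hM hp
  obtain ⟨j, hj⟩ := Infinite.exists_notMem_finset (r a).support
  -- The head `t` includes index `j`, so the tail `w` lies in subgroup `j + 1` at every coordinate.
  let t : ℕ →₀ M := Finsupp.indicator (Finset.range (j + 1)) fun k _ => a k
  let w : ℕ → M := fun k => if k < j + 1 then 0 else a k
  have haw : a = Finsupp.lcoeFun (R := R) t + w := by
    ext k
    by_cases hk : k < j + 1 <;> simp only [t, w, Pi.add_apply, Finsupp.lcoeFun_apply,
      Finsupp.indicator_apply, Finset.mem_range, hk, ↓reduceIte, ↓reduceDIte, add_zero, zero_add]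
  have hw : w ∈ (φ (j + 1)).carrier (ℕ → M) := PPFormula.carrier_pi _ fun k => by
    by_cases hk : k < j + 1
    · simpa only [w, hk, ↓reduceIte] using PPFormula.zero_mem _
    · simpa only [w, hk, ↓reduceIte] using hanti (not_lt.1 hk) (ha k)
  have h1 : r w j ∈ (φ (j + 1)).carrier M :=
    (PPFormula.carrier_finsupp _).1 (PPFormula.map_mem hw r) j
  have h2 : r a j = a j + r w j := by
    rw [haw, map_add, hr, Finsupp.add_apply, ← haw]
    simp [t, Finsupp.indicator_apply]
  rw [Finsupp.notMem_support_iff.1 hj, eq_comm, add_eq_zero_iff_eq_neg] at h2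
  exact ha' j (h2 ▸ PPFormula.neg_mem h1)

theorem isSigmaPureInjective_iff : IsSigmaPureInjective R M ↔ IsPPArtinian R M :=
  ⟨IsSigmaPureInjective.isPPArtinian, fun h => (h.finsupp ℕ).isPureInjective⟩

end Retraction

/-! ### Endomorphisms of indecomposable pure-injectives -/

section Endomorphisms

variable {R : Type u} [Ring R] {M N E F : Type u} [AddCommGroup M] [Module R M]
  [AddCommGroup N] [Module R N] [AddCommGroup E] [Module R E] [AddCommGroup F] [Module R F]

/-- In a pure-injective module, a directed family of endomorphisms has a limit endomorphism which
keeps the eventual fixed points and the eventually satisfied positive primitive conditions. -/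
theorem IsPureInjective.exists_limit (hE : IsPureInjective R E) {I : Type u} (l : Filter I)
    [l.NeBot] (g : I → E →ₗ[R] E) :
    ∃ h : E →ₗ[R] E, (∀ x, (∀ᶠ i in l, g i x = x) → h x = x) ∧
      ∀ (m n : ℕ) (A : Matrix (Fin m) (Fin n) R) (b : Fin m → E),
        (∀ᶠ i in l, Solvable A (fun k => g i (b k))) → Solvable A (fun k => h (b k)) := by
  classical
  -- The reduced power modulo `Z` contains `E` purely on the diagonal; the limit is the class of the
  -- family `g`, retracted to `E`.
  let Z : Submodule R (I → E) :=
    { carrier := {f | ∀ᶠ i in l, f i = 0}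
      add_mem' := fun ha hb => by filter_upwards [ha, hb] with i h h'; simp [h, h']
      zero_mem' := by simp
      smul_mem' := fun r f hf => by filter_upwards [hf] with i h; simp [h] }
  let δ : E →ₗ[R] (I → E) ⧸ Z := Z.mkQ ∘ₗ LinearMap.pi fun _ => LinearMap.id
  have hδ : IsPureEmbedding δ := isPureEmbedding_mkQ_comp_iff.2 fun m n A b y hy => by
    have h : ∀ᶠ i in l, ∀ k, ∑ j, A k j • y j i - b k = 0 := by
      refine Filter.eventually_all.2 fun k => ?_
      filter_upwards [hy k] with i hi
      simpa using hi
    obtain ⟨i, hi⟩ := h.exists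
    exact ⟨fun j => y j i, fun k => sub_eq_zero.1 (hi k)⟩
  obtain ⟨ρ, hρ⟩ := hE.exists_retraction hδ
  refine ⟨ρ ∘ₗ Z.mkQ ∘ₗ LinearMap.pi g, fun x hx => ?_, fun m n A b hb => ?_⟩
  · have : Z.mkQ (LinearMap.pi g x) = δ x := (Submodule.Quotient.eq Z).2 (by
      filter_upwards [hx] with i hi
      simp [hi])
    simp only [LinearMap.comp_apply, this, hρ]
  · let y : Fin n → I → E := fun j i =>
      if h : Solvable A (fun k => g i (b k)) then h.choose j else 0
    refine Solvable.map (b := fun k => Z.mkQ (LinearMap.pi g (b k)))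
      ⟨fun j => Z.mkQ (y j), fun k => ?_⟩ ρ
    rw [← sub_eq_zero]
    simp only [← map_smul, ← map_sum, ← map_sub]
    refine (Submodule.Quotient.mk_eq_zero Z).2 ?_
    filter_upwards [hb] with i hi
    simpa [y, hi, sub_eq_zero] using hi.choose_spec k

variable (R M) in
/-- A nonzero module whose only direct summands are the trivial ones. -/
structure IsIndecomposable : Prop where
  nontrivial : Nontrivial M
  eq_id : ∀ e : M →ₗ[R] M, (∀ x, e (e x) = e x) → (∃ x, e x ≠ 0) → e = LinearMap.id

/-- The positive primitive conditions on the values of an endomorphism, and its fixed points. -/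
def endoDiagram (g : E →ₗ[R] E) :
    Set (Σ m n : ℕ, Matrix (Fin m) (Fin n) R × (Fin m → E)) × Set E :=
  ({t | Solvable t.2.2.1 fun i => g (t.2.2.2 i)}, {x | g x = x})

/-- Zorn's lemma: a chain is bounded by its limit along `atTop`, which keeps everything that
eventually holds. -/
theorem IsPureInjective.exists_maximal_endoDiagram (hE : IsPureInjective R E) (g₀ : E →ₗ[R] E) :
    ∃ g : E →ₗ[R] E, endoDiagram g₀ ≤ endoDiagram g ∧
      ∀ h : E →ₗ[R] E, endoDiagram g ≤ endoDiagram h → endoDiagram h ≤ endoDiagram g := by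
  let : Preorder (E →ₗ[R] E) := Preorder.lift endoDiagram
  have hub : ∀ c ⊆ Set.Ici g₀, IsChain (· ≤ ·) c → ∀ y ∈ c, ∃ ub, ∀ z ∈ c, z ≤ ub := by
    intro c _ hc y hy
    have hne : Nonempty c := ⟨⟨y, hy⟩⟩
    have hdir : IsDirected c (· ≤ ·) := ⟨hc.directed⟩
    obtain ⟨h, hfix, hpp⟩ := hE.exists_limit (Filter.atTop : Filter c) Subtype.val
    refine ⟨h, fun z hz => ⟨fun t ht => hpp _ _ _ _ ?_, fun x hx => hfix x ?_⟩⟩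
    · filter_upwards [Filter.eventually_ge_atTop ⟨z, hz⟩] with i hi
      exact hi.1 ht
    · filter_upwards [Filter.eventually_ge_atTop ⟨z, hz⟩] with i hi
      exact hi.2 hx
  obtain ⟨g, hg, hmax⟩ := zorn_le_nonempty_Ici₀ g₀ hub g₀ le_rfl
  exact ⟨g, hg, fun h hh => hmax hh⟩

/-- Every endomorphism `g₀` is dominated by an idempotent fixing all fixed points of `g₀`. -/
theorem IsPureInjective.exists_idempotent (hE : IsPureInjective R E) (g₀ : E →ₗ[R] E) :
    ∃ e : E →ₗ[R] E, (∀ x, e (e x) = e x) ∧ endoDiagram g₀ ≤ endoDiagram e := by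
  obtain ⟨g, hg, hmax⟩ := hE.exists_maximal_endoDiagram g₀
  have hsq : endoDiagram g ≤ endoDiagram (g ∘ₗ g) :=
    ⟨fun t ht => Solvable.map ht g, fun x (hx : g x = x) => by
      change g (g x) = x
      rw [hx, hx]⟩
  -- By maximality `g ∘ g` satisfies no more pp conditions than `g`, so `g` factors as `k ∘ g ∘ g`.
  -- Then `k ∘ g` dominates `g` and fixes its range; maximality again makes `g` fix its own range.
  obtain ⟨k, hk⟩ := hE.exists_factor (g ∘ₗ g) g fun m n A b hb =>
    (hmax _ hsq).1 (show (⟨m, n, A, b⟩ : Σ m n : ℕ, Matrix (Fin m) (Fin n) R × (Fin m → E)) ∈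
      (endoDiagram (g ∘ₗ g)).1 from hb)
  have hk' : ∀ x, k (g (g x)) = g x := hk
  have hkg : endoDiagram g ≤ endoDiagram (k ∘ₗ g) :=
    ⟨fun t ht => Solvable.map ht k, fun x (hx : g x = x) => by
      change k (g x) = x
      nth_rewrite 1 [← hx]
      rw [hk', hx]⟩
  exact ⟨g, fun x => (hmax _ hkg).2 (hk' x), hg⟩

/-- The idempotent dominating `g` fixes `y`, so it is the identity. Thus `g` satisfies no pp
condition that the identity does not: it is pure, and splits. -/
theorem IsIndecomposable.exists_leftInverse (hE : IsIndecomposable R E) (hinj : IsPureInjective R E)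
    {g : E →ₗ[R] E} {y : E} (hy : y ≠ 0) (hg : g y = y) :
    ∃ r : E →ₗ[R] E, ∀ x, r (g x) = x := by
  obtain ⟨e, he, hle⟩ := hinj.exists_idempotent g
  have hey : e y = y := hle.2 hg
  obtain rfl := hE.eq_id e he ⟨y, by rwa [hey]⟩
  exact hinj.exists_retraction (isPureEmbedding_of_reflect fun m n A b hb =>
    hle.1 (show (⟨m, n, A, b⟩ : Σ m n : ℕ, Matrix (Fin m) (Fin n) R × (Fin m → E)) ∈
      (endoDiagram g).1 from hb))

/-- A nonzero element generating a minimal nonzero positive primitive subgroup can be recovered from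
each of its nonzero images. -/
theorem IsPPArtinian.exists_recoverable [Nontrivial E] (hE : IsPPArtinian R E) :
    ∃ y : E, y ≠ 0 ∧ ∀ θ : E →ₗ[R] E, θ y ≠ 0 → ∃ k : E →ₗ[R] E, k (θ y) = y := by
  obtain ⟨x, hx⟩ := exists_ne (0 : E)
  obtain ⟨φ, ⟨y, hy, hy0⟩, hmin⟩ := hE.exists_minimal
    (S := {φ | ∃ y ∈ φ.carrier E, y ≠ 0}) ⟨PPFormula.top R, x, PPFormula.mem_top x, hx⟩
  refine ⟨y, hy0, fun θ hθ => ?_⟩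
  obtain ⟨k, hk⟩ := hE.isPureInjective.exists_factor (LinearMap.toSpanSingleton R E (θ y))
    (LinearMap.toSpanSingleton R E y) fun m n A b hb => by
      let ψ : PPFormula R := ⟨Fin m, Fin n, A, b⟩
      -- Conjoining with `ψ` still leaves the nonzero element `θ y`, so minimality puts `y` in `ψ`
      -- as well.
      have hψ : θ y ∈ (φ.conj ψ).carrier E := by
        rw [PPFormula.carrier_conj]
        exact ⟨PPFormula.map_mem hy θ, by simpa [PPFormula.carrier, ψ] using hb⟩
      have := hmin (φ.conj ψ) ⟨_, hψ, hθ⟩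
        (by rw [PPFormula.carrier_conj]; exact Set.inter_subset_left) hy
      rw [PPFormula.carrier_conj] at this
      simpa [PPFormula.carrier, ψ] using this.2
  exact ⟨k, by simpa using hk 1⟩

theorem IsIndecomposable.nonempty_linearEquiv_of_leftInverse [Nontrivial E]
    (hF : IsIndecomposable R F) {s : E →ₗ[R] F} {r : F →ₗ[R] E} (h : ∀ x, r (s x) = x) :
    Nonempty (E ≃ₗ[R] F) := by
  obtain ⟨x, hx⟩ := exists_ne (0 : E)
  have := hF.eq_id (s ∘ₗ r) (fun y => by simp [h])
    ⟨s x, fun h0 => hx (by simpa [h] using congrArg r h0)⟩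
  exact ⟨LinearEquiv.ofLinearMap s r this (LinearMap.ext h)⟩

/-- The components satisfy `∑ r i (s i y) = y`, so some `r i (s i y)` is nonzero and a suitable `k`
returns it to `y`. Then `k ∘ r i ∘ s i` fixes `y` and has a left inverse, so `s i` is a split
embedding into the indecomposable `F`. -/
theorem IsIndecomposable.nonempty_linearEquiv_of_finsupp (hE : IsIndecomposable R E)
    (hF : IsIndecomposable R F) (hEA : IsPPArtinian R E) {I : Type u}
    [Nonempty I] (e : (I →₀ E) ≃ₗ[R] (I →₀ F)) : Nonempty (E ≃ₗ[R] F) := by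
  classical
  have := hE.nontrivial
  obtain ⟨y, hy0, hy⟩ := hEA.exists_recoverable
  obtain ⟨i₀⟩ := ‹Nonempty I›
  let s (i : I) : E →ₗ[R] F := Finsupp.lapply i ∘ₗ e.toLinearMap ∘ₗ Finsupp.lsingle i₀
  let r (i : I) : F →ₗ[R] E := Finsupp.lapply i₀ ∘ₗ e.symm.toLinearMap ∘ₗ Finsupp.lsingle i
  have hsum : ∑ i ∈ (e (Finsupp.single i₀ y)).support, r i (s i y) = y := by
    have h : e.symm (∑ i ∈ (e (Finsupp.single i₀ y)).support,
        Finsupp.single i (e (Finsupp.single i₀ y) i)) = Finsupp.single i₀ y := by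
      rw [LinearEquiv.symm_apply_eq]
      exact Finsupp.sum_single _
    simpa [r, s, map_sum, Finsupp.finsetSum_apply] using congrArg (fun f => f i₀) h
  obtain ⟨i, -, hi⟩ := Finset.exists_ne_zero_of_sum_ne_zero (hsum ▸ hy0)
  obtain ⟨k, hk⟩ := hy (r i ∘ₗ s i) hi
  obtain ⟨q, hq⟩ := hE.exists_leftInverse hEA.isPureInjective (g := k ∘ₗ r i ∘ₗ s i) hy0 hk
  exact hF.nonempty_linearEquiv_of_leftInverse (s := s i) (r := q ∘ₗ k ∘ₗ r i) hq

end Endomorphisms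
end ModuleCategoricity

namespace ModuleCategoricity

/-! ### Decomposition into indecomposables -/

section Decomposition

variable {R : Type u} [Ring R] {M : Type u} [AddCommGroup M] [Module R M]

theorem isPureEmbedding_ker_of_idempotent {e : M →ₗ[R] M} (he : ∀ x, e (e x) = e x) :
    IsPureEmbedding (LinearMap.ker e).subtype :=
  isPureEmbedding_subtype_iff.2 fun m n A b hb ⟨y, hy⟩ =>
    ⟨fun j => y j - e (y j), fun j => by simp [he], fun i => by
      have h := congrArg e (hy i)
      rw [LinearMap.mem_ker.1 (hb i), map_sum] at h
      simp only [map_smul] at h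
      simp [smul_sub, Finset.sum_sub_distrib, hy, h]⟩

theorem IsPPArtinian.exists_projection (hM : IsPPArtinian R M) {U : Submodule R M}
    (hU : IsPureEmbedding U.subtype) :
    ∃ q : M →ₗ[R] M, (∀ x, q (q x) = q x) ∧ LinearMap.ker q = U := by
  obtain ⟨r, hr⟩ := (hM.of_pure hU).exists_retraction hU
  refine ⟨LinearMap.id - U.subtype ∘ₗ r, fun x => ?_, Submodule.ext fun x => ?_⟩
  · have : r (r x : M) = r x := hr _
    simp [this]
  · rw [LinearMap.mem_ker, LinearMap.sub_apply, sub_eq_zero]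
    exact ⟨fun h => by rw [show x = r x from h]; exact (r x).2,
      fun h => (congrArg U.subtype (hr ⟨x, h⟩)).symm⟩

/-- A complement of a pure submodule maximal among those avoiding a given element is
indecomposable. -/
theorem isIndecomposable_range_of_maximal {q : M →ₗ[R] M} (hq : ∀ x, q (q x) = q x) {x : M}
    (hx : q x ≠ 0)
    (hmax : ∀ U : Submodule R M, IsPureEmbedding U.subtype → x ∉ U → LinearMap.ker q ≤ U →
      U ≤ LinearMap.ker q) : IsIndecomposable R (LinearMap.range q) := by
  have hqC : ∀ c : LinearMap.range q, q c = c := by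
    rintro ⟨_, y, rfl⟩
    exact hq y
  have hqR : ∀ c : LinearMap.range q, q.rangeRestrict c = c := fun c => Subtype.ext (hqC c)
  refine ⟨⟨0, q.rangeRestrict x, fun h => hx (congrArg Subtype.val h).symm⟩,
    fun e he ⟨c₀, hc₀⟩ => ?_⟩
  let e' : M →ₗ[R] M := (LinearMap.range q).subtype ∘ₗ e ∘ₗ q.rangeRestrict
  have he'C : ∀ c : LinearMap.range q, e' c = e c := fun c => by simp [e', hqR]
  have he'q : ∀ y, e' (q y) = e' y := fun y => he'C (q.rangeRestrict y)
  have hqe' : ∀ y, q (e' y) = e' y := fun y => hqC _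
  have he' : ∀ y, e' (e' y) = e' y := fun y => by
    change e' (e (q.rangeRestrict y) : LinearMap.range q) = _
    rw [he'C, he]
    rfl
  -- Both `ker (q - e')` and `ker e'` are pure and contain `ker q`, and `x` is not in both since `q
  -- x ≠ 0`. Maximality bounds whichever avoids `x` by `ker q`; for the first this would kill `e
  -- c₀`, so it is the second, which gives `e = id`.
  have hx1 : x ∈ LinearMap.ker (q - e') := by
    by_contra hx1
    have h := hmax _ (isPureEmbedding_ker_of_idempotent (e := q - e')
      (fun y => by simp [hq, hqe', he'q, he'])) hx1 (fun y hy => by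
        rw [LinearMap.mem_ker] at hy ⊢
        rw [LinearMap.sub_apply, ← he'q, hy, map_zero, sub_zero])
    have h1 : (e c₀ : M) ∈ LinearMap.ker q := h (by
      rw [LinearMap.mem_ker, LinearMap.sub_apply, he'C, he, hqC, sub_self])
    rw [LinearMap.mem_ker, hqC] at h1
    exact hc₀ (Subtype.ext h1)
  have hx2 : x ∉ LinearMap.ker e' := fun h => hx (by
    rw [LinearMap.mem_ker] at h hx1
    rwa [LinearMap.sub_apply, h, sub_zero] at hx1)
  have h := hmax _ (isPureEmbedding_ker_of_idempotent he') hx2 (fun y hy => by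
    rw [LinearMap.mem_ker] at hy ⊢
    rw [← he'q, hy, map_zero])
  refine LinearMap.ext fun c => ?_
  have h1 : ((c - e c : LinearMap.range q) : M) ∈ LinearMap.ker q := h (by
    rw [LinearMap.mem_ker, he'C, map_sub, he, sub_self]
    rfl)
  rw [LinearMap.mem_ker, hqC] at h1
  exact (sub_eq_zero.1 (Subtype.ext h1 : c - e c = 0)).symm

/-- Enlarge `T` to a pure submodule maximal without `x`; it splits off, and its complement serves as
`C`. Purity of `C ⊔ T` comes from solving a system separately after `q` and after `id - q`. -/
theorem IsPPArtinian.exists_isIndecomposable (hM : IsPPArtinian R M) {T : Submodule R M}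
    (hT : IsPureEmbedding T.subtype) {x : M} (hx : x ∉ T) :
    ∃ C : Submodule R M, IsIndecomposable R C ∧ Disjoint C T ∧
      IsPureEmbedding (C ⊔ T).subtype := by
  obtain ⟨U, hTU, hU⟩ := zorn_le_nonempty₀
    {U : Submodule R M | IsPureEmbedding U.subtype ∧ x ∉ U}
    (fun c hc hchain y hy => ⟨sSup c,
      ⟨isPureEmbedding_subtype_sSup hchain ⟨y, hy⟩ fun U hU => (hc hU).1, fun hx => by
        obtain ⟨U, hU, hxU⟩ := (Submodule.mem_sSup_of_directed ⟨y, hy⟩ hchain.directedOn).1 hx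
        exact (hc hU).2 hxU⟩, fun _ => le_sSup⟩) T ⟨hT, hx⟩
  obtain ⟨q, hq, rfl⟩ := hM.exists_projection hU.1.1
  refine ⟨LinearMap.range q, isIndecomposable_range_of_maximal hq hU.1.2
    fun V hV hxV hle => hU.2 ⟨hV, hxV⟩ hle, ?_, ?_⟩
  · rw [Submodule.disjoint_def]
    rintro _ ⟨y, rfl⟩ hy
    rw [← hq]
    exact hTU hy
  · refine isPureEmbedding_subtype_iff.2 fun m n A b hb ⟨y, hy⟩ => ?_
    have hbT : ∀ i, b i - q (b i) ∈ T := fun i => by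
      obtain ⟨_, ⟨z, rfl⟩, t, ht, h⟩ := Submodule.mem_sup.1 (hb i)
      rw [← h, map_add, hq, LinearMap.mem_ker.1 (hTU ht)]
      simpa using ht
    obtain ⟨w, hw, hs⟩ := isPureEmbedding_subtype_iff.1 hT m n A _ hbT
      (Solvable.sub ⟨y, hy⟩ (Solvable.map ⟨y, hy⟩ q))
    refine ⟨fun j => q (y j) + w j, fun j => Submodule.add_mem_sup ⟨_, rfl⟩ (hw j), fun i => ?_⟩
    have h := congrArg q (hy i)
    rw [map_sum] at h
    simp only [map_smul] at h
    simp [smul_add, Finset.sum_add_distrib, hs, h]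

theorem sSupIndep_insert {S : Set (Submodule R M)} (hS : sSupIndep S) {C : Submodule R M}
    (hC : Disjoint C (sSup S)) : sSupIndep (insert C S) := by
  intro a ha
  by_cases haC : a = C
  · subst haC
    exact hC.mono_right (sSup_le_sSup fun b hb => hb.1.resolve_left hb.2)
  · have haS : a ∈ S := ha.resolve_left haC
    have h1 : Disjoint a (sSup (S \ {a})) := hS haS
    have h2 : Disjoint (a ⊔ sSup (S \ {a})) C :=
      hC.symm.mono_left (sup_le (le_sSup haS) (sSup_le_sSup Set.sdiff_subset))
    refine (h1.disjoint_sup_right_of_disjoint_sup_left h2).mono_right (sSup_le ?_)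
    rintro b ⟨rfl | hb, hba⟩
    · exact le_sup_right
    · exact (le_sSup (show b ∈ S \ {a} from ⟨hb, hba⟩)).trans le_sup_left

/-- Zorn's lemma on independent families of indecomposables. Requiring the sum to be pure survives
chains and lets another summand be added while the sum is proper. -/
theorem IsPPArtinian.exists_decomposition (hM : IsPPArtinian R M) :
    ∃ S : Set (Submodule R M), sSupIndep S ∧ sSup S = ⊤ ∧ ∀ N ∈ S, IsIndecomposable R N := by
  let F : Set (Set (Submodule R M)) := {S | sSupIndep S ∧ IsPureEmbedding (sSup S).subtype ∧
    ∀ N ∈ S, IsIndecomposable R N}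
  have hunion : ∀ c ⊆ F, IsChain (· ⊆ ·) c → c.Nonempty → ⋃₀ c ∈ F := by
    refine fun c hc hchain hne => ⟨?_, ?_, ?_⟩
    · rw [Set.sUnion_eq_iUnion]
      exact sSupIndep_iUnion_of_directed hchain.directed fun i => (hc i.2).1
    · rw [sSup_sUnion, ← sSup_image]
      refine isPureEmbedding_subtype_sSup ?_ (hne.image _) ?_
      · rintro _ ⟨S, hS, rfl⟩ _ ⟨T, hT, rfl⟩ -
        exact (hchain.total hS hT).imp sSup_le_sSup sSup_le_sSup
      · rintro _ ⟨S, hS, rfl⟩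
        exact (hc hS).2.1
    · rintro N ⟨S, hS, hN⟩
      exact (hc hS).2.2 N hN
  have hempty : ∅ ∈ F := by
    refine ⟨sSupIndep_empty, ?_, by simp⟩
    rw [sSup_empty]
    exact isPureEmbedding_of_comp_eq_id (r := 0) fun x => Subsingleton.elim _ _
  obtain ⟨S, -, hS⟩ := zorn_subset_nonempty F (fun c hc hchain hne =>
    ⟨⋃₀ c, hunion c hc hchain hne, fun _ => Set.subset_sUnion_of_mem⟩) ∅ hempty
  obtain ⟨hind, hpure, hdec⟩ := hS.1
  refine ⟨S, hind, ?_, hdec⟩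
  by_contra htop
  obtain ⟨x, hx⟩ : ∃ x, x ∉ sSup S := by
    by_contra! h
    exact htop (eq_top_iff.2 fun x _ => h x)
  obtain ⟨C, hC, hdisj, hCp⟩ := hM.exists_isIndecomposable hpure hx
  have hCS : C ∈ S := hS.2 ⟨sSupIndep_insert hind hdisj, by rwa [sSup_insert], fun N hN =>
    hN.elim (fun h => h ▸ hC) (hdec N)⟩ (Set.subset_insert C S) (Set.mem_insert C S)
  have := hC.nontrivial
  exact (Submodule.nontrivial_iff_ne_bot.1 this) (disjoint_self.1 (hdisj.mono_right (le_sSup hCS)))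

end Decomposition

/-! ### Size of indecomposables -/

section Cardinality

open Cardinal

variable {R : Type u} [Ring R] {M : Type u} [AddCommGroup M] [Module R M]

/-- The language with a function symbol for each component of a solution of `A x = C b`. -/
def solutionLanguage (R : Type u) : FirstOrder.Language.{u, 0} where
  Functions k := Σ m n : ℕ, Matrix (Fin m) (Fin n) R × Matrix (Fin m) (Fin k) R × Fin n
  Relations _ := Empty

open Classical in
/-- The function symbols of `solutionLanguage R` interpreted by chosen solutions. -/
@[reducible] noncomputable def solutionStructure (R : Type u) [Ring R] (M : Type u) [AddCommGroup M]
    [Module R M] : FirstOrder.Language.Structure (solutionLanguage R) M where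
  funMap := fun {_} f b =>
    if h : Solvable f.2.2.1 (fun i => ∑ k, f.2.2.2.1 i k • b k) then h.choose f.2.2.2.2 else 0
  RelMap := fun r => r.elim

theorem mk_matrix_le (R : Type u) (m n : ℕ) : #(Matrix (Fin m) (Fin n) R) ≤ max #R ℵ₀ := by
  have key (X : Type u) (k : ℕ) : #(Fin k → X) ≤ max #X ℵ₀ := by
    simpa [-le_sup_iff] using power_nat_le_max (c := #X) (n := k)
  exact (key _ _).trans (max_le (key _ _) (le_max_right _ _))

theorem mk_sigma_nat_le {B : Cardinal.{u}} (hB : ℵ₀ ≤ B) {f : ℕ → Type u} (h : ∀ n, #(f n) ≤ B) :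
    #(Σ n, f n) ≤ B := by
  rw [mk_sigma]
  refine (sum_le_sum _ (fun _ => B) h).trans ?_
  rw [sum_const]
  simpa using mul_le_of_le hB hB le_rfl

theorem mk_solutionLanguage_functions_le (R : Type u) :
    #(Σ k : ℕ, (solutionLanguage R).Functions k) ≤ max #R ℵ₀ := by
  have hB : ℵ₀ ≤ max #R ℵ₀ := le_max_right _ _
  refine mk_sigma_nat_le hB fun k => mk_sigma_nat_le hB fun m => mk_sigma_nat_le hB fun n => ?_
  have h1 : #(Matrix (Fin m) (Fin k) R × Fin n) ≤ max #R ℵ₀ := by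
    rw [mk_prod]
    refine mul_le_of_le hB ?_ ?_
    · simpa using mk_matrix_le R m k
    · exact le_trans (by simp) hB
  rw [mk_prod, lift_id, lift_id]
  exact mul_le_of_le hB (mk_matrix_le R m n) h1

/-- Every element lies in a small pure submodule. -/
theorem exists_pure_mk_le (y : M) :
    ∃ U : Submodule R M, y ∈ U ∧ IsPureEmbedding U.subtype ∧ #U ≤ #R + ℵ₀ := by
  let := solutionStructure R M
  -- A Löwenheim–Skolem hull: closing `y` under chosen solutions gives purity, and the module
  -- operations are themselves solutions of single equations.
  let S := FirstOrder.Language.Substructure.closure (solutionLanguage R) ({y} : Set M)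
  have hS : ∀ {m n k : ℕ} (A : Matrix (Fin m) (Fin n) R) (C : Matrix (Fin m) (Fin k) R)
      (b : Fin k → M), (∀ i, b i ∈ S) → Solvable A (fun i => ∑ l, C i l • b l) →
      ∃ x : Fin n → M, (∀ j, x j ∈ S) ∧ ∀ i, ∑ j, A i j • x j = ∑ l, C i l • b l := by
    intro m n k A C b hb h
    refine ⟨h.choose, fun j => ?_, h.choose_spec⟩
    let f : (solutionLanguage R).Functions k := ⟨m, n, A, C, j⟩
    have hf : FirstOrder.Language.Structure.funMap f b = h.choose j := dif_pos h
    exact hf ▸ S.fun_mem f b hb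
  let U : Submodule R M :=
    { carrier := S
      add_mem' := fun {a b} ha hb => by
        obtain ⟨x, hx, h⟩ := hS (m := 1) (n := 1) (fun _ _ => 1) (fun _ _ => 1) ![a, b]
          (fun i => by fin_cases i <;> assumption) ⟨fun _ => a + b, fun i => by simp⟩
        have := h 0
        simp only [Fin.isValue, Finset.univ_unique, Fin.default_eq_zero,
          one_smul, Finset.sum_singleton, Fin.sum_univ_two, Matrix.cons_val_zero,
          Matrix.cons_val_one] at this
        exact this ▸ hx 0
      zero_mem' := by
        obtain ⟨x, hx, h⟩ := hS (m := 1) (n := 1) (fun _ _ => 1) 0 (fun _ => y)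
          (fun i => i.elim0) ⟨fun _ => 0, fun i => by simp⟩
        have := h 0
        simp only [Fin.isValue, Finset.univ_unique, Fin.default_eq_zero,
          one_smul, Finset.sum_singleton, Finset.univ_eq_empty, Finset.sum_empty] at this
        exact this ▸ hx 0
      smul_mem' := fun r a ha => by
        obtain ⟨x, hx, h⟩ := hS (m := 1) (n := 1) (k := 1) (fun _ _ => 1) (fun _ _ => r) (fun _ => a)
          (fun i => ha) ⟨fun _ => r • a, fun i => by simp⟩
        have := h 0
        simp only [Fin.isValue, Finset.univ_unique, Fin.default_eq_zero,
          one_smul, Finset.sum_singleton] at this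
        exact this ▸ hx 0 }
  refine ⟨U, FirstOrder.Language.Substructure.subset_closure rfl,
    isPureEmbedding_subtype_iff.2 fun m n A b hb h => ?_, ?_⟩
  · change ∃ x : Fin n → M, (∀ j, x j ∈ S) ∧ _
    simpa [Matrix.one_apply] using hS A 1 b hb (by simpa [Matrix.one_apply] using h)
  · have h := FirstOrder.Language.Substructure.lift_card_closure_le (L := solutionLanguage R) (M := M)
      (s := ({y} : Set M))
    simp only [lift_id, mk_fintype, Fintype.card_unique, Nat.cast_one] at h
    refine le_trans h (max_le le_add_self (add_le_of_le le_add_self ?_ ?_))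
    · exact one_le_aleph0.trans le_add_self
    · exact (mk_solutionLanguage_functions_le R).trans
        (max_le le_self_add le_add_self)

/-- A small pure submodule around a nonzero element splits off, hence is everything. -/
theorem IsIndecomposable.mk_le (hM : IsIndecomposable R M) (hA : IsPPArtinian R M) :
    #M ≤ #R + ℵ₀ := by
  have := hM.nontrivial
  obtain ⟨y, hy⟩ := exists_ne (0 : M)
  obtain ⟨U, hyU, hU, hcard⟩ := exists_pure_mk_le (R := R) y
  obtain ⟨r, hr⟩ := (hA.of_pure hU).exists_retraction hU
  have hid := hM.eq_id (U.subtype ∘ₗ r) (fun x => congrArg U.subtype (hr (r x)))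
    ⟨y, by rw [LinearMap.comp_apply, show r y = ⟨y, hyU⟩ from hr ⟨y, hyU⟩]; exact hy⟩
  refine (mk_le_of_surjective (f := U.subtype) fun x => ⟨r x, ?_⟩).trans hcard
  exact LinearMap.congr_fun hid x

end Cardinality

/-! ### Transfer of categoricity -/

section Categoricity

open Cardinal

variable {R : Type u} [Ring R]

theorem exists_retract_of_mem_sSupIndep {M : Type u} [AddCommGroup M] [Module R M]
    {S : Set (Submodule R M)} (hS : sSupIndep S) (htop : sSup S = ⊤) {N : Submodule R M}
    (hN : N ∈ S) : ∃ r : M →ₗ[R] N, ∀ x : N, r x = x := by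
  have hc : IsCompl N (sSup (S \ {N})) := by
    refine ⟨hS hN, codisjoint_iff.2 ?_⟩
    rw [← sSup_insert, Set.insert_sdiff_singleton, Set.insert_eq_of_mem hN, htop]
  exact ⟨Submodule.projectionOnto _ _ hc, Submodule.projectionOnto_apply_left hc⟩

theorem nonempty_linearEquiv_finsupp {M E : Type u} [AddCommGroup M] [Module R M]
    [AddCommGroup E] [Module R E] {S : Set (Submodule R M)} (hS : sSupIndep S)
    (htop : sSup S = ⊤) (h : ∀ N ∈ S, Nonempty (N ≃ₗ[R] E)) : Nonempty (M ≃ₗ[R] (S →₀ E)) := by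
  classical
  have e : ∀ N : S, N.1 ≃ₗ[R] E := fun N => (h N.1 N.2).some
  have hind : iSupIndep (fun N : S => N.1) := (sSupIndep_iff S).1 hS
  have e' := hind.linearEquiv (by rw [← sSup_eq_iSup', htop])
  exact ⟨e'.symm ≪≫ₗ DFinsupp.mapRange.linearEquiv e ≪≫ₗ (finsuppLequivDFinsupp R).symm⟩

theorem mk_finsupp_le (I E : Type u) [AddCommGroup E] : #(I →₀ E) ≤ max (max #I #E) ℵ₀ := by
  rcases finite_or_infinite I with hI | hI
  · have := Fintype.ofFinite I
    rw [mk_finsupp_of_fintype]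
    exact power_nat_le_max.trans (max_le_max_right _ (le_max_right _ _))
  · rcases subsingleton_or_nontrivial E with hE | hE
    · exact (le_one_iff_subsingleton.2 inferInstance).trans
        (one_le_aleph0.trans (le_max_right _ _))
    · rw [mk_finsupp_of_infinite]
      exact le_max_left _ _

/-- If all members of a class of modules decompose into small pieces which can be recovered from
their direct powers, then categoricity transfers between all large cardinals. -/
theorem isCategorical_transfer
    {K Good : ∀ (M : Type u) [AddCommGroup M] [Module R M], Prop}
    (hfinsupp : ∀ (M : Type u) [AddCommGroup M] [Module R M] (I : Type u), K M → K (I →₀ M))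
    (hretract : ∀ (M N : Type u) [AddCommGroup M] [Module R M] [AddCommGroup N] [Module R N]
      (s : N →ₗ[R] M) (r : M →ₗ[R] N), (∀ x, r (s x) = x) → K M → K N)
    (hdecomp : ∀ (M : Type u) [AddCommGroup M] [Module R M], K M →
      ∃ S : Set (Submodule R M), sSupIndep S ∧ sSup S = ⊤ ∧ ∀ N ∈ S, Good N)
    (hnontrivial : ∀ (M : Type u) [AddCommGroup M] [Module R M], Good M → Nontrivial M)
    (hcard : ∀ (M : Type u) [AddCommGroup M] [Module R M], K M → Good M → #M ≤ #R + ℵ₀)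
    (hiso : ∀ (E F : Type u) [AddCommGroup E] [Module R E] [AddCommGroup F] [Module R F]
      (I : Type u) [Nonempty I], K E → K F → Good E → Good F →
      Nonempty ((I →₀ E) ≃ₗ[R] (I →₀ F)) → Nonempty (E ≃ₗ[R] F)) :
    (∀ κ : Cardinal.{u}, #R + ℵ₀ < κ → IsCategorical R K κ) ↔
      ∃ κ : Cardinal.{u}, #R + ℵ₀ < κ ∧ IsCategorical R K κ := by
  refine ⟨fun h => ⟨_, cantor _, h _ (cantor _)⟩, ?_⟩
  rintro ⟨κ, hκ, ⟨M, _, _, hM, hMκ⟩, huniq⟩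
  have hsmall : ∀ (N : Type u) [AddCommGroup N] [Module R N], K N → Good N →
      ∀ μ, #R + ℵ₀ < μ → #(μ.out →₀ N) = μ := by
    intro N _ _ hN hgN μ hμ
    have := hnontrivial N hgN
    have : Infinite μ.out := by
      rw [infinite_iff, mk_out]
      exact le_add_self.trans hμ.le
    rw [mk_finsupp_of_infinite, mk_out, max_eq_left ((hcard N hN hgN).trans hμ.le)]
  have hKmem : ∀ (N : Type u) [AddCommGroup N] [Module R N], K N →
      ∀ S : Set (Submodule R N), sSupIndep S → sSup S = ⊤ → ∀ F ∈ S, K F := by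
    intro N _ _ hN S hS htop F hF
    obtain ⟨r, hr⟩ := exists_retract_of_mem_sSupIndep hS htop hF
    exact hretract N F F.subtype r hr hN
  obtain ⟨S, hS, htop, hgood⟩ := hdecomp M hM
  have hSne : S.Nonempty := by
    by_contra hempty
    rw [Set.not_nonempty_iff_eq_empty] at hempty
    rw [hempty, sSup_empty] at htop
    have : Subsingleton M := (Submodule.subsingleton_iff R).1 (subsingleton_of_bot_eq_top htop)
    exact (one_le_aleph0.trans le_add_self).not_gt
      (hκ.trans_le (hMκ ▸ le_one_iff_subsingleton.2 this))
  obtain ⟨E, hE⟩ := hSne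
  have hKE := hKmem M hM S hS htop E hE
  have hgE := hgood E hE
  intro μ hμ
  have hmodel : ∀ (N : Type u) [AddCommGroup N] [Module R N], K N → #N = μ →
      Nonempty (N ≃ₗ[R] (μ.out →₀ E)) := by
    intro N _ _ hN hNμ
    obtain ⟨T, hT, hTtop, hgT⟩ := hdecomp N hN
    -- Categoricity in `κ` is used only here, on the `κ`-th powers of `F` and `E`, whatever the size
    -- `μ` of `N`.
    have hTE : ∀ F ∈ T, Nonempty (F ≃ₗ[R] E) := fun F hF => by
      have hKF := hKmem N hN T hT hTtop F hF
      have : Nonempty κ.out := by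
        rw [← mk_ne_zero_iff, mk_out]
        exact (zero_le.trans_lt hκ).ne'
      exact hiso F E κ.out hKF hKE (hgT F hF) hgE
        (huniq _ _ (hfinsupp _ _ hKF) (hsmall F hKF (hgT F hF) κ hκ)
          (hfinsupp _ _ hKE) (hsmall E hKE hgE κ hκ))
    obtain ⟨e⟩ := nonempty_linearEquiv_finsupp hT hTtop hTE
    -- Since `E` and `ℵ₀` are smaller than `μ`, only the number of summands can account for the size
    -- of `N`.
    have hTμ : #T = μ := by
      have hlarge : μ ≤ max (max #T #E) ℵ₀ := by
        rw [← hNμ, e.toEquiv.cardinal_eq]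
        exact mk_finsupp_le _ _
      have hle : μ ≤ #T := by
        by_contra hlt
        refine hlarge.not_gt (max_lt (max_lt (not_le.1 hlt) ?_) (le_add_self.trans_lt hμ))
        exact (hcard E hKE hgE).trans_lt hμ
      refine le_antisymm ?_ hle
      have := hnontrivial E hgE
      have : Infinite T := by
        rw [infinite_iff]
        exact le_add_self.trans (hμ.le.trans hle)
      rw [← hNμ, e.toEquiv.cardinal_eq, mk_finsupp_of_infinite]
      exact le_max_left _ _
    obtain ⟨f⟩ := Cardinal.eq.1 (hTμ.trans (mk_out μ).symm)
    exact ⟨e ≪≫ₗ Finsupp.domLCongr f⟩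
  refine ⟨⟨μ.out →₀ E, inferInstance, inferInstance, hfinsupp _ _ hKE, hsmall E hKE hgE μ hμ⟩,
    fun N N' _ _ _ _ hN hNμ hN' hNμ' => ?_⟩
  obtain ⟨e⟩ := hmodel N hN hNμ
  obtain ⟨e'⟩ := hmodel N' hN' hNμ'
  exact ⟨e ≪≫ₗ e'.symm⟩

end Categoricity

/-! ### The three classes -/

section Classes

variable {R : Type u} [Ring R] {M N : Type u} [AddCommGroup M] [Module R M] [AddCommGroup N]
  [Module R N]

theorem injective_of_retract (hM : Module.Injective R M) (s : N →ₗ[R] M) (r : M →ₗ[R] N)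
    (h : ∀ x, r (s x) = x) : Module.Injective R N := by
  refine ⟨fun X Y _ _ _ _ f hf g => ?_⟩
  obtain ⟨k, hk⟩ := hM.out f hf (s ∘ₗ g)
  exact ⟨r ∘ₗ k, fun x => by simp [hk, h]⟩

theorem IsSigmaInjective.of_retract (hM : IsSigmaInjective R M) (s : N →ₗ[R] M) (r : M →ₗ[R] N)
    (h : ∀ x, r (s x) = x) : IsSigmaInjective R N := fun I =>
  injective_of_retract (hM I) (Finsupp.mapRange.linearMap s) (Finsupp.mapRange.linearMap r)
    fun f => by ext i; simp [h]

theorem IsSigmaInjective.finsupp (hM : IsSigmaInjective R M) (I : Type u) :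
    IsSigmaInjective R (I →₀ M) := fun J =>
  let e : (J × I →₀ M) ≃ₗ[R] (J →₀ I →₀ M) := Finsupp.curryLinearEquiv R
  injective_of_retract (hM (J × I)) e.symm.toLinearMap e.toLinearMap e.apply_symm_apply

/-- Injectivity of the countable power gives its pure-injectivity; `ULift` moves `ℕ` to the universe
of the index sets. -/
theorem IsSigmaInjective.isPPArtinian (hM : IsSigmaInjective R M) : IsPPArtinian R M := by
  refine IsSigmaPureInjective.isPPArtinian fun A B _ _ _ _ i hi g => ?_
  let e : (ULift.{u} ℕ →₀ M) ≃ₗ[R] (ℕ →₀ M) := Finsupp.domLCongr Equiv.ulift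
  obtain ⟨h, hh⟩ := (injective_of_retract (hM (ULift.{u} ℕ)) e.symm.toLinearMap e.toLinearMap
    e.apply_symm_apply).out i hi.1 g
  exact ⟨h, LinearMap.ext hh⟩

theorem mk_le_of_isSimpleModule [IsSimpleModule R M] : Cardinal.mk M ≤ Cardinal.mk R := by
  have := IsSimpleModule.nontrivial R M
  obtain ⟨x, hx⟩ := exists_ne (0 : M)
  exact Cardinal.mk_le_of_surjective (IsSimpleModule.toSpanSingleton_surjective R hx)

/-- Schur's lemma: some component of `e` is nonzero, hence bijective. -/
theorem nonempty_linearEquiv_of_isSimpleModule [IsSimpleModule R M] [IsSimpleModule R N]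
    {I : Type u} [Nonempty I] (e : (I →₀ M) ≃ₗ[R] (I →₀ N)) : Nonempty (M ≃ₗ[R] N) := by
  classical
  have := IsSimpleModule.nontrivial R M
  obtain ⟨x, hx⟩ := exists_ne (0 : M)
  obtain ⟨i⟩ := ‹Nonempty I›
  have hne : e (Finsupp.single i x) ≠ 0 := by simpa using hx
  obtain ⟨j, hj⟩ := Finsupp.ne_iff.1 hne
  let f : M →ₗ[R] N := Finsupp.lapply j ∘ₗ e.toLinearMap ∘ₗ Finsupp.lsingle i
  exact ⟨LinearEquiv.ofBijective f (f.bijective_of_ne_zero fun h => hj (LinearMap.congr_fun h x))⟩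

end Classes

end ModuleCategoricity

theorem corollary2p8 (R : Type u) [Ring R] :
    ((∀ κ : Cardinal.{u}, Cardinal.mk R + Cardinal.aleph0 < κ →
        ModuleCategoricity.IsCategorical R
          (fun M _ _ => ModuleCategoricity.IsSigmaInjective R M) κ) ↔
      (∃ κ : Cardinal.{u}, Cardinal.mk R + Cardinal.aleph0 < κ ∧
        ModuleCategoricity.IsCategorical R
          (fun M _ _ => ModuleCategoricity.IsSigmaInjective R M) κ)) ∧
    ((∀ κ : Cardinal.{u}, Cardinal.mk R + Cardinal.aleph0 < κ →
        ModuleCategoricity.IsCategorical R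
          (fun M _ _ => ModuleCategoricity.IsSigmaPureInjective R M) κ) ↔
      (∃ κ : Cardinal.{u}, Cardinal.mk R + Cardinal.aleph0 < κ ∧
        ModuleCategoricity.IsCategorical R
          (fun M _ _ => ModuleCategoricity.IsSigmaPureInjective R M) κ)) ∧
    ((∀ κ : Cardinal.{u}, Cardinal.mk R + Cardinal.aleph0 < κ →
        ModuleCategoricity.IsCategorical R
          (fun M _ _ => IsSemisimpleModule R M) κ) ↔
      (∃ κ : Cardinal.{u}, Cardinal.mk R + Cardinal.aleph0 < κ ∧
        ModuleCategoricity.IsCategorical R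
          (fun M _ _ => IsSemisimpleModule R M) κ)) := by

  refine ⟨?_, ?_, ?_⟩
  · exact ModuleCategoricity.isCategorical_transfer
      (Good := fun M _ _ => ModuleCategoricity.IsIndecomposable R M)
      (fun M _ _ I hM => hM.finsupp I) (fun M N _ _ _ _ s r h hM => hM.of_retract s r h)
      (fun M _ _ hM => hM.isPPArtinian.exists_decomposition) (fun M _ _ hM => hM.nontrivial)
      (fun M _ _ hM hgM => hgM.mk_le hM.isPPArtinian)
      (fun E F _ _ _ _ I _ hE _ hgE hgF ⟨e⟩ =>
        hgE.nonempty_linearEquiv_of_finsupp hgF hE.isPPArtinian e)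
  · simp only [ModuleCategoricity.isSigmaPureInjective_iff]
    exact ModuleCategoricity.isCategorical_transfer
      (Good := fun M _ _ => ModuleCategoricity.IsIndecomposable R M)
      (fun M _ _ I hM => hM.finsupp I)
      (fun M N _ _ _ _ s r h hM =>
        hM.of_pure (ModuleCategoricity.isPureEmbedding_of_comp_eq_id h))
      (fun M _ _ hM => hM.exists_decomposition) (fun M _ _ hM => hM.nontrivial)
      (fun M _ _ hM hgM => hgM.mk_le hM)
      (fun E F _ _ _ _ I _ hE _ hgE hgF ⟨e⟩ => hgE.nonempty_linearEquiv_of_finsupp hgF hE e)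
  · exact ModuleCategoricity.isCategorical_transfer
      (Good := fun M _ _ => IsSimpleModule R M)
      (fun M _ _ I hM => inferInstance)
      (fun M N _ _ _ _ s r h hM => IsSemisimpleModule.of_injective s
        (Function.LeftInverse.injective h))
      (fun M _ _ hM => IsSemisimpleModule.exists_sSupIndep_sSup_simples_eq_top R M)
      (fun M _ _ hM => IsSimpleModule.nontrivial R M)
      (fun M _ _ _ hgM => ModuleCategoricity.mk_le_of_isSimpleModule.trans le_self_add)
      (fun E F _ _ _ _ I _ _ _ hgE hgF ⟨e⟩ =>
        ModuleCategoricity.nonempty_linearEquiv_of_isSimpleModule e)
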